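/- Let $U$ be the hyperbolic plane (the lattice with Gram matrix $\begin{pmatrix}0&1\\1&0\end{pmatrix}$) and let $L=U^{\oplus 3}\oplus\langle -6\rangle$. Call a vector $h\in L$ \emph{split} if it is primitive and $(h,L)=\mathbb{Z}$. Write $\mathrm{O}^+(L,h)$ for the group of isometries $g$ of $L$ with $g(h)=h$ that have real spinor norm $1$, where the spinor norm of a product of reflections in $v_1,\dots,v_m\in L\otimes\mathbb{R}$ is the class of $\prod_i\bigl(-\tfrac12(v_i,v_i)\bigr)$ in $\mathbb{R}^*/(\mathbb{R}^*)^2$. Let $p>3$ be a prime, let $h_{2p^2}\in L$ be split with $(h_{2p^2},h_{2p^2})=2p^2$, and let $h_2\in L$ be split with $(h_2,h_2)=2$. (Then $h_2^\perp\cong L_{6,2}$ and $h_{2p^2}^\perp\cong L_{6,2p^2}$, where $L_{6,2d}=U^{\oplus 2}\oplus\langle -6\rangle\oplus\langle -2d\rangle$.) Lattice embeddings (injective, form-preserving homomorphisms) $\varphi:h_{2p^2}^\perp\hookrightarrow h_2^\perp$ exist. For every such $\varphi$ there is an injective group homomorphism $\iota:\mathrm{O}^+(L,h_{2p^2})\to\mathrm{O}^+(L,h_2)$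 with $\iota(g)(\varphi(x))=\varphi(g(x))$ for all $g\in\mathrm{O}^+(L,h_{2p^2})$ and $x\in h_{2p^2}^\perp$, and, when $\mathrm{O}^+(L,h_{2p^2})$ is regarded as a subgroup of $\mathrm{O}^+(L,h_2)$ through $\iota$, it has finite index, with $$\bigl|\mathrm{O}^+(L,h_2):\mathrm{O}^+(L,h_{2p^2})\bigr|\le 16\,(p^5+p^2).$$ -/

import Mathlib

namespace KummerLattice

/-- The Gram matrix of `L = U ⊕ U ⊕ U ⊕ ⟨-6⟩` on the basis `e₁, f₁, e₂, f₂, e₃, f₃, w`, where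
`eᵢ, fᵢ` is a standard basis of the `i`-th hyperbolic plane and `w` generates `⟨-6⟩`. -/
def gram : Matrix (Fin 7) (Fin 7) ℤ :=
  !![0, 1, 0, 0, 0, 0, 0;
     1, 0, 0, 0, 0, 0, 0;
     0, 0, 0, 1, 0, 0, 0;
     0, 0, 1, 0, 0, 0, 0;
     0, 0, 0, 0, 0, 1, 0;
     0, 0, 0, 0, 1, 0, 0;
     0, 0, 0, 0, 0, 0, -6]

/-- The abelian group underlying the lattice `L = U ⊕ U ⊕ U ⊕ ⟨-6⟩`. -/
abbrev L : Type := Fin 7 → ℤ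

/-- The real quadratic space `L ⊗ ℝ`. -/
abbrev LR : Type := Fin 7 → ℝ

/-- The bilinear form of `L`. -/
noncomputable def form : LinearMap.BilinForm ℤ L := Matrix.toBilin' gram

/-- The real extension of the bilinear form of `L`, on `L ⊗ ℝ`. -/
noncomputable def formR : LinearMap.BilinForm ℝ LR :=
  Matrix.toBilin' (gram.map (Int.cast : ℤ → ℝ))

/-- The inclusion `L → L ⊗ ℝ`. -/
def toReal (x : L) : LR := fun i => (x i : ℝ)

/-- `h` is primitive: it is only divisible by units. -/
def IsPrimitive (h : L) : Prop := ∀ (m : ℤ) (x : L), h = m • x → IsUnit m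

/-- `h` is split: it is primitive and `div h = 1`, where `div h` is the positive generator of the
ideal `(h, L)` of `ℤ`. -/
def IsSplit (h : L) : Prop := IsPrimitive h ∧ LinearMap.range (form h) = (⊤ : Ideal ℤ)

/-- The orthogonal group `O(L)`. -/
def orthogonalGroup : Subgroup (L ≃ₗ[ℤ] L) where
  carrier := {g | ∀ x y, form (g x) (g y) = form x y}
  one_mem' := fun _ _ => rfl
  mul_mem' := fun {a b} ha hb x y => by
    simp only [Set.mem_ofPred_eq] at ha hb
    rw [LinearEquiv.mul_apply, LinearEquiv.mul_apply, ha, hb]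
  inv_mem' := fun {a} ha x y => by
    have := ha (a⁻¹ x) (a⁻¹ y)
    rw [← LinearEquiv.mul_apply, ← LinearEquiv.mul_apply, mul_inv_cancel] at this
    exact this.symm

/-- The reflection `x ↦ x - 2 (v, x) / (v, v) v` of `L ⊗ ℝ` in a vector `v` with `(v, v) ≠ 0`. -/
noncomputable def reflection (v : LR) : Module.End ℝ LR :=
  LinearMap.id - ((2 / formR v v) • formR v).smulRight v

theorem reflection_apply (v x : LR) :
    reflection v x = x - (2 / formR v v * formR v x) • v := by
  simp [reflection]

theorem reflection_mul_self (v : LR) (hv : formR v v ≠ 0) : reflection v * reflection v = 1 := by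
  refine LinearMap.ext fun x => ?_
  rw [Module.End.mul_apply, Module.End.one_apply, reflection_apply, reflection_apply]
  simp only [map_sub, map_smul, smul_eq_mul]
  rw [sub_sub, ← add_smul]
  have : 2 / formR v v * formR v x +
      2 / formR v v * (formR v x - 2 / formR v v * formR v x * formR v v) = 0 := by
    field_simp
    ring
  rw [this, zero_smul, sub_zero]

theorem prod_reverse_mul_prod (vs : List LR) (hvs : ∀ v ∈ vs, formR v v ≠ 0) :
    (vs.reverse.map reflection).prod * (vs.map reflection).prod = 1 := by
  induction vs with
  | nil => simp
  | cons v vs ih =>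
    have h1 := reflection_mul_self v (hvs v (by simp))
    have h2 := ih fun u hu => hvs u (by simp [hu])
    simp only [List.reverse_cons, List.map_append, List.map_cons, List.map_nil, List.prod_append,
      List.prod_cons, List.prod_nil, mul_one]
    rw [mul_assoc, ← mul_assoc (reflection v), h1, one_mul, h2]

/-- `g` has real spinor norm `1`: the real extension of `g` is a product of reflections in
non-isotropic vectors `v₁, …, vₘ` of `L ⊗ ℝ` for which `∏ (-(vᵢ, vᵢ) / 2)` is a square in `ℝˣ`,
that is, positive. With this sign the spinor norm of the reflection in a vector of negative square
is `1`. -/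
def HasSpinorNormOne (g : L ≃ₗ[ℤ] L) : Prop :=
  ∃ vs : List LR, (∀ v ∈ vs, formR v v ≠ 0) ∧
    (∀ x : L, (vs.map reflection).prod (toReal x) = toReal (g x)) ∧
    0 < (vs.map fun v => -formR v v / 2).prod

/-- The group `O⁺(L)` of elements of `O(L)` of real spinor norm `1`. -/
def orthogonalGroupPlus : Subgroup (L ≃ₗ[ℤ] L) where
  carrier := {g | g ∈ orthogonalGroup ∧ HasSpinorNormOne g}
  one_mem' := ⟨one_mem _, [], by simp, by simp, by simp⟩
  mul_mem' := by
    rintro a b ⟨ha, us, hu, hua, hup⟩ ⟨hb, vs, hv, hvb, hvp⟩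
    refine ⟨mul_mem ha hb, us ++ vs, ?_, ?_, ?_⟩
    · intro v hvm
      rcases List.mem_append.1 hvm with h | h
      exacts [hu v h, hv v h]
    · intro x
      rw [List.map_append, List.prod_append, Module.End.mul_apply, hvb, hua]
      rfl
    · rw [List.map_append, List.prod_append]
      exact mul_pos hup hvp
  inv_mem' := by
    rintro a ⟨ha, vs, hv, hva, hvp⟩
    refine ⟨inv_mem ha, vs.reverse, fun v h => hv v (List.mem_reverse.1 h), ?_, ?_⟩
    · intro x
      have h1 : toReal x = (vs.map reflection).prod (toReal (a⁻¹ x)) := by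
        rw [hva, ← LinearEquiv.mul_apply, mul_inv_cancel]
        rfl
      rw [h1, ← Module.End.mul_apply, prod_reverse_mul_prod vs hv]
      rfl
    · rw [List.map_reverse, List.prod_reverse]
      exact hvp

/-- The group `O⁺(L, h)` of elements of `O(L)` that fix `h` and have real spinor norm `1`. -/
def stabPlus (h : L) : Subgroup (L ≃ₗ[ℤ] L) where
  carrier := {g | g ∈ orthogonalGroupPlus ∧ g h = h}
  one_mem' := ⟨one_mem _, rfl⟩
  mul_mem' := by
    rintro a b ⟨ha, ha'⟩ ⟨hb, hb'⟩
    exact ⟨mul_mem ha hb, by rw [LinearEquiv.mul_apply, hb', ha']⟩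
  inv_mem' := by
    rintro a ⟨ha, ha'⟩
    refine ⟨inv_mem ha, ?_⟩
    conv_lhs => rw [← ha']
    rw [← LinearEquiv.mul_apply, inv_mul_cancel]
    rfl

/-- The orthogonal complement `h^⊥` of `h` in `L`. -/
noncomputable def perp (h : L) : Submodule ℤ L := LinearMap.ker (form h)

theorem apply_mem_perp {h : L} (g : stabPlus h) (x : perp h) : g.1 (x : L) ∈ perp h := by
  have h1 := g.2.1.1 h (x : L)
  rw [g.2.2] at h1
  exact LinearMap.mem_ker.2 (h1.trans (LinearMap.mem_ker.1 x.2))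

/-- The action of `O⁺(L, h)` on the lattice `h^⊥`. -/
noncomputable def actPerp {h : L} (g : stabPlus h) (x : perp h) : perp h :=
  ⟨g.1 (x : L), apply_mem_perp g x⟩

/-- `φ : h^⊥ → k^⊥` is an embedding of lattices: it is injective and preserves the forms. -/
def IsLatticeEmbedding {h k : L} (φ : perp h →ₗ[ℤ] perp k) : Prop :=
  Function.Injective φ ∧ ∀ x y : perp h, form (φ x : L) (φ y : L) = form (x : L) (y : L)

end KummerLattice

namespace KummerLattice

/-! Eichler's criterion moves `h` to e₁ + p²f₁ and `k` to e₁ + f₁. The crux is rigidity: up to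
isometries of L there is only one embedding φ, namely e₁ - p²f₁ ↦ p(e₁ - f₁) with the identity on
the complement of the first hyperbolic plane (`exists_normal_form`). Hence p·φ is the restriction of
a similarity of L with factor p², the diagonal map δ = `scale (p ^ 2) 1 p`, which sends e₁ + p²f₁ to
p²(e₁ + f₁).

Over ℚ, ι is conjugation by δ. It keeps the spinor norm because the factor of δ is positive, and it
keeps integrality because an isometry fixing e₁ + p²f₁ fixes e₁ modulo p²
(`scale_conj_dvd_of_fixes`). Conversely, conjugation by δ⁻¹ keeps an isometry fixing e₁ + f₁
integral once it fixes f₁ modulo p (`scale_conj_dvd_of_congr`). So g ↦ g(f₁) mod p takes different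
values on different left cosets of the range of ι. The values are isotropic vectors of L/pL having
product 1 with e₁ + f₁. Five coordinates determine such a vector up to the sign of its last one, so
the index is at most 2p⁵, which is below the stated bound. -/

theorem form_apply (x y : L) : form x y = x 0 * y 1 + x 1 * y 0 + x 2 * y 3 + x 3 * y 2
    + x 4 * y 5 + x 5 * y 4 - 6 * (x 6 * y 6) := by
  simp [form, Matrix.toBilin'_apply, gram, Fin.sum_univ_succ]
  ring

theorem form_comm (x y : L) : form x y = form y x := by
  rw [form_apply, form_apply]; ring

theorem transpose_toMatrix_mul_gram (f : L →ₗ[ℤ] L) (A : Matrix (Fin 7) (Fin 7) ℤ)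
    (hf : ∀ x y, form (f x) (f y) = Matrix.toBilin' A x y) :
    (LinearMap.toMatrix' f).transpose * gram * LinearMap.toMatrix' f = A := by
  have h : form.comp f f = Matrix.toBilin' A := LinearMap.ext₂ hf
  have := congrArg LinearMap.BilinForm.toMatrix' h
  rwa [LinearMap.BilinForm.toMatrix'_comp, LinearMap.BilinForm.toMatrix'_toBilin', form,
    LinearMap.BilinForm.toMatrix'_toBilin'] at this

/-- Six times the inverse of `gram`. -/
def gramCofactor : Matrix (Fin 7) (Fin 7) ℤ :=
  !![0, 6, 0, 0, 0, 0, 0;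
     6, 0, 0, 0, 0, 0, 0;
     0, 0, 0, 6, 0, 0, 0;
     0, 0, 6, 0, 0, 0, 0;
     0, 0, 0, 0, 0, 6, 0;
     0, 0, 0, 0, 6, 0, 0;
     0, 0, 0, 0, 0, 0, -1]

theorem gram_mul_gramCofactor : gram * gramCofactor = (6 : ℤ) • 1 := by
  decide

theorem det_gram_ne_zero : gram.det ≠ 0 := by
  intro h
  have := congrArg Matrix.det gram_mul_gramCofactor
  rw [Matrix.det_mul, h, zero_mul, Matrix.det_smul, Matrix.det_one] at this
  norm_num at this

/-- An endomorphism of `L` that preserves the form is an isometry of `L`. -/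
theorem exists_mem_orthogonalGroup (f : L →ₗ[ℤ] L)
    (hf : ∀ x y, form (f x) (f y) = form x y) :
    ∃ g ∈ orthogonalGroup, ∀ x, g x = f x := by
  have h1 := congrArg Matrix.det (transpose_toMatrix_mul_gram f gram hf)
  rw [Matrix.det_mul, Matrix.det_mul, Matrix.det_transpose, LinearMap.det_toMatrix'] at h1
  have h2 : LinearMap.det f * LinearMap.det f = 1 := by
    apply mul_right_cancel₀ det_gram_ne_zero
    linear_combination h1
  have h3 : IsUnit (LinearMap.det f) := IsUnit.of_mul_eq_one _ h2
  exact ⟨LinearEquiv.ofIsUnitDet (v := Pi.basisFun ℤ (Fin 7)) (v' := Pi.basisFun ℤ (Fin 7)) (f := f)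
    (by simpa using h3), hf, fun x => rfl⟩

theorem mul_eq_smul_one_comm {n : ℕ} {A B : Matrix (Fin n) (Fin n) ℤ} {c : ℤ} (hc : c ≠ 0)
    (h : A * B = c • 1) : B * A = c • 1 := by
  have hA : A.det ≠ 0 := by
    intro h0
    have := congrArg Matrix.det h
    rw [Matrix.det_mul, h0, zero_mul, Matrix.det_smul, Matrix.det_one, mul_one] at this
    exact pow_ne_zero _ hc this.symm
  have h1 : A * (B * A) = A * (c • 1) := by
    rw [← mul_assoc, h, Matrix.smul_mul, Matrix.mul_smul, one_mul, mul_one]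
  have h2 := congrArg (A.adjugate * ·) h1
  simp only [← mul_assoc, Matrix.adjugate_mul] at h2
  rw [Matrix.smul_mul, Matrix.smul_mul, Matrix.one_mul, Matrix.smul_mul, Matrix.one_mul] at h2
  exact smul_right_injective _ hA h2

/-! ### Eichler transvections and the orbits of split vectors -/

/-- The Eichler transvection attached to an isotropic vector `e` and a vector `a` orthogonal to
`e` with `(a, a) = 2 q`. -/
noncomputable def eichler (e a : L) (q : ℤ) : L →ₗ[ℤ] L :=
  LinearMap.id - (form a).smulRight e + (form e).smulRight a - q • (form e).smulRight e

theorem eichler_apply (e a : L) (q : ℤ) (x : L) :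
    eichler e a q x = x - form a x • e + form e x • a - q • form e x • e := rfl

theorem eichler_coord (e a : L) (q : ℤ) (x : L) (i : Fin 7) :
    eichler e a q x i = x i - form a x * e i + form e x * a i - q * (form e x * e i) := rfl

theorem form_eichler {e a : L} {q : ℤ} (he : form e e = 0) (hea : form e a = 0)
    (ha : form a a = 2 * q) (x y : L) :
    form (eichler e a q x) (eichler e a q y) = form x y := by
  have hae : form a e = 0 := by rw [form_comm, hea]
  simp only [eichler_apply, map_add, map_sub, map_smul, LinearMap.add_apply, LinearMap.sub_apply,
    LinearMap.smul_apply, smul_eq_mul, he, hea, ha, hae, form_comm x e, form_comm x a]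
  ring

/-- `x` and `y` lie in the same orbit of `O(L)`. -/
def SameOrbit (x y : L) : Prop := ∃ g ∈ orthogonalGroup, g x = y

theorem SameOrbit.trans {x y z : L} : SameOrbit x y → SameOrbit y z → SameOrbit x z := by
  rintro ⟨g, hg, rfl⟩ ⟨g', hg', rfl⟩
  exact ⟨g' * g, mul_mem hg' hg, rfl⟩

theorem SameOrbit.symm {x y : L} : SameOrbit x y → SameOrbit y x := by
  rintro ⟨g, hg, rfl⟩
  exact ⟨g⁻¹, inv_mem hg, by rw [← LinearEquiv.mul_apply, inv_mul_cancel]; rfl⟩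

theorem SameOrbit.form_self {x y : L} : SameOrbit x y → form x x = form y y := by
  rintro ⟨g, hg, rfl⟩
  exact (hg x x).symm

theorem sameOrbit_of_linearMap (f : L →ₗ[ℤ] L) (hf : ∀ x y, form (f x) (f y) = form x y) (x : L) :
    SameOrbit x (f x) := by
  obtain ⟨g, hg, h⟩ := exists_mem_orthogonalGroup f hf
  exact ⟨g, hg, h x⟩

theorem sameOrbit_eichler {e a : L} {q : ℤ} (he : form e e = 0) (hea : form e a = 0)
    (ha : form a a = 2 * q) (x : L) : SameOrbit x (eichler e a q x) :=
  sameOrbit_of_linearMap _ (form_eichler he hea ha) x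

theorem sameOrbit_perm (σ : Fin 7 → Fin 7)
    (h : ∀ x y : L, form (x ∘ σ) (y ∘ σ) = form x y) (x : L) : SameOrbit x (x ∘ σ) :=
  sameOrbit_of_linearMap (LinearMap.funLeft ℤ ℤ σ) h x

theorem sameOrbit_swap_first (x : L) :
    SameOrbit x ![x 1, x 0, x 2, x 3, x 4, x 5, x 6] := by
  convert sameOrbit_perm ![1, 0, 2, 3, 4, 5, 6] (fun x y => ?_) x using 1
  · ext i; fin_cases i <;> rfl
  · simp [form_apply]; ring

theorem sameOrbit_swap_second (x : L) :
    SameOrbit x ![x 0, x 1, x 3, x 2, x 4, x 5, x 6] := by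
  convert sameOrbit_perm ![0, 1, 3, 2, 4, 5, 6] (fun x y => ?_) x using 1
  · ext i; fin_cases i <;> rfl
  · simp [form_apply]; ring

theorem sameOrbit_swap_first_second (x : L) :
    SameOrbit x ![x 2, x 3, x 0, x 1, x 4, x 5, x 6] := by
  convert sameOrbit_perm ![2, 3, 0, 1, 4, 5, 6] (fun x y => ?_) x using 1
  · ext i; fin_cases i <;> rfl
  · simp [form_apply]; ring

theorem sameOrbit_swap_second_third (x : L) :
    SameOrbit x ![x 0, x 1, x 4, x 5, x 2, x 3, x 6] := by
  convert sameOrbit_perm ![0, 1, 4, 5, 2, 3, 6] (fun x y => ?_) x using 1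
  · ext i; fin_cases i <;> rfl
  · simp [form_apply]; ring

theorem SameOrbit.exists_form_eq_one {x y : L} (h : SameOrbit x y) (hx : ∃ u, form x u = 1) :
    ∃ u, form y u = 1 := by
  obtain ⟨g, hg, rfl⟩ := h
  obtain ⟨u, hu⟩ := hx
  exact ⟨g u, by rw [hg, hu]⟩

theorem exists_sameOrbit_zero_ne_zero {x : L} (hx : ∃ u, form x u = 1) :
    ∃ y, SameOrbit x y ∧ y 0 ≠ 0 := by
  by_contra! h
  have h0 := h
  have h1 : ∀ y, SameOrbit x y → y 1 = 0 := fun y hy => h0 _ (hy.trans (sameOrbit_swap_first y))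
  have h2 : ∀ y, SameOrbit x y → y 2 = 0 := fun y hy =>
    h0 _ (hy.trans (sameOrbit_swap_first_second y))
  have h3 : ∀ y, SameOrbit x y → y 3 = 0 := fun y hy => h2 _ (hy.trans (sameOrbit_swap_second y))
  have h4 : ∀ y, SameOrbit x y → y 4 = 0 := fun y hy =>
    h2 _ (hy.trans (sameOrbit_swap_second_third y))
  have h5 : ∀ y, SameOrbit x y → y 5 = 0 := fun y hy =>
    h3 _ (hy.trans (sameOrbit_swap_second_third y))
  obtain ⟨u, hu⟩ := hx
  have hxx : SameOrbit x x := ⟨1, one_mem _, rfl⟩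
  rw [form_apply, h0 x hxx, h1 x hxx, h2 x hxx, h3 x hxx, h4 x hxx, h5 x hxx] at hu
  omega

/-- A vector `x` with `(x, L) = ℤ` can be moved by `O(L)` to one whose first coordinate is `1`. -/
theorem exists_sameOrbit_zero_eq_one {x : L} (hx : ∃ u, form x u = 1) :
    ∃ y, SameOrbit x y ∧ y 0 = 1 := by
  classical
  -- Euclidean descent: take the least nonzero |y₀| in the orbit and show that y₀ divides (x, L) =
  -- ℤ.
  have hex : ∃ n : ℕ, 0 < n ∧ ∃ y, SameOrbit x y ∧ (y 0).natAbs = n := by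
    obtain ⟨y, hy, hy0⟩ := exists_sameOrbit_zero_ne_zero hx
    exact ⟨_, Int.natAbs_pos.2 hy0, y, hy, rfl⟩
  obtain ⟨hpos, y, hy, hym⟩ := Nat.find_spec hex
  have hmin : ∀ z, SameOrbit x z → (z 0).natAbs < Nat.find hex → z 0 = 0 := by
    intro z hz hlt
    by_contra h0
    exact Nat.find_min hex hlt ⟨Int.natAbs_pos.2 h0, z, hz, rfl⟩
  generalize Nat.find hex = m at *
  have key : ∀ z, SameOrbit x z → (z 0).natAbs = m → z 0 ∣ z 2 := by
    intro z hz hzm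
    have hz0 : z 0 ≠ 0 := by omega
    -- This transvection replaces z₂ by its remainder modulo z₀, and the swap brings the remainder
    -- to position 0, where minimality kills it.
    have h1 := (hz.trans (sameOrbit_eichler (e := Pi.single 1 1) (a := Pi.single 2 (-(z 2 / z 0)))
      (q := 0) (by simp [form_apply]) (by simp [form_apply]) (by simp [form_apply]) z)).trans
      (sameOrbit_swap_first_second _)
    have h2 := hmin _ h1
    have h3 : z 2 + -(z 0 * (z 2 / z 0)) = z 2 % z 0 := by
      rw [Int.emod_def]; ring
    have h4 := Int.emod_nonneg (z 2) hz0
    have h5 := Int.emod_lt_abs (z 2) hz0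
    simp [eichler_coord, form_apply] at h2
    apply Int.dvd_of_emod_eq_zero
    rw [Int.abs_eq_natAbs] at h5
    rw [h3] at h2
    apply h2
    omega
  have key3 : ∀ z, SameOrbit x z → (z 0).natAbs = m → z 0 ∣ z 3 := fun z hz hzm =>
    key _ (hz.trans (sameOrbit_swap_second z)) hzm
  obtain ⟨z, hz, hzm, hz3⟩ : ∃ z, SameOrbit x z ∧ (z 0).natAbs = m ∧ z 3 = 0 := by
    obtain ⟨t, ht⟩ := key3 y hy hym
    refine ⟨_, hy.trans (sameOrbit_eichler (e := Pi.single 1 1) (a := Pi.single 3 (-t))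
      (q := 0) (by simp [form_apply]) (by simp [form_apply]) (by simp [form_apply]) y), ?_, ?_⟩
    · simpa [eichler_coord, form_apply] using hym
    · simp [eichler_coord, form_apply, ht]
  have d2 := key z hz hzm
  have d4 : z 0 ∣ z 4 := key _ (hz.trans (sameOrbit_swap_second_third z)) hzm
  have d5 : z 0 ∣ z 5 := key3 _ (hz.trans (sameOrbit_swap_second_third z)) hzm
  -- As z₃ = 0, transvections along e₂ leave z₀ alone; those with a = e₁ and a = w turn z₂ into z₂ -
  -- z₁ and z₂ + 6z₆, to which `key` applies again.
  have d1 : z 0 ∣ z 1 := by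
    have := key _ (hz.trans (sameOrbit_eichler (e := Pi.single 2 1) (a := Pi.single 0 1)
      (q := 0) (by simp [form_apply]) (by simp [form_apply]) (by simp [form_apply]) z))
    simp [eichler_coord, form_apply, hz3] at this
    exact (dvd_sub_right d2).1 (this hzm)
  have d6 : z 0 ∣ 6 * z 6 := by
    have := key _ (hz.trans (sameOrbit_eichler (e := Pi.single 2 1) (a := Pi.single 6 1)
      (q := -3) (by simp [form_apply]) (by simp [form_apply]) (by simp [form_apply]) z))
    simp [eichler_coord, form_apply, hz3] at this
    exact (dvd_add_right d2).1 (this hzm)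
  have hunit : z 0 ∣ 1 := by
    obtain ⟨u, hu⟩ := hz.exists_form_eq_one hx
    rw [form_apply, hz3, ← mul_assoc] at hu
    rw [← hu]
    refine dvd_sub (dvd_add (dvd_add (dvd_add (dvd_add (dvd_add ?_ ?_) ?_) ?_) ?_) ?_) ?_
    exacts [dvd_mul_right _ _, d1.mul_right _, d2.mul_right _, by simp, d4.mul_right _,
      d5.mul_right _, d6.mul_right _]
  rcases Int.isUnit_iff.1 (isUnit_of_dvd_one hunit) with h | h
  · exact ⟨z, hz, h⟩
  · exact ⟨-z, hz.trans (sameOrbit_of_linearMap (-LinearMap.id) (by simp) z), by simp [h]⟩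

/-- The vector `e₁ + d f₁`, of square `2 d`. -/
def standardVector (d : ℤ) : L := ![1, d, 0, 0, 0, 0, 0]

theorem form_standardVector (d : ℤ) (x : L) : form (standardVector d) x = x 1 + d * x 0 := by
  simp [form_apply, standardVector]

/-- Eichler's criterion for split vectors. -/
theorem sameOrbit_standardVector {h : L} (hs : IsSplit h) {d : ℤ} (hd : form h h = 2 * d) :
    SameOrbit (standardVector d) h := by
  have hx : ∃ u, form h u = 1 := by
    have : (1 : ℤ) ∈ LinearMap.range (form h) := by rw [hs.2]; trivial
    exact this
  obtain ⟨y, hy, hy0⟩ := exists_sameOrbit_zero_eq_one hx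
  -- Since y₀ = 1, this transvection along f₁ clears coordinates 2 to 6; the square of the vector
  -- then forces coordinate 1.
  have h1 := hy.trans (sameOrbit_eichler (e := Pi.single 1 1)
    (a := ![0, 0, -y 2, -y 3, -y 4, -y 5, -y 6])
    (q := y 2 * y 3 + y 4 * y 5 - 3 * (y 6 * y 6)) (by simp [form_apply]) (by simp [form_apply])
    (by simp [form_apply]; ring) y)
  generalize hz : eichler _ _ _ y = z at h1
  have z0 : z 0 = 1 := by simp [← hz, eichler_coord, form_apply, hy0]
  have z2 : z 2 = 0 := by simp [← hz, eichler_coord, form_apply, hy0]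
  have z3 : z 3 = 0 := by simp [← hz, eichler_coord, form_apply, hy0]
  have z4 : z 4 = 0 := by simp [← hz, eichler_coord, form_apply, hy0]
  have z5 : z 5 = 0 := by simp [← hz, eichler_coord, form_apply, hy0]
  have z6 : z 6 = 0 := by simp [← hz, eichler_coord, form_apply, hy0]
  have z1 : z 1 = d := by
    have := h1.form_self
    rw [hd, form_apply, z0, z2, z3, z4, z5, z6] at this
    linarith
  have : z = standardVector d := by
    ext i; fin_cases i <;> simp [standardVector, z0, z1, z2, z3, z4, z5, z6]
  exact this ▸ h1.symm

/-! ### Rigidity of the embedding -/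

/-- The diagonal endomorphism of `L` with entries `a, b, c, c, c, c, c`. -/
noncomputable def scale (a b c : ℤ) : L →ₗ[ℤ] L :=
  LinearMap.pi fun i => (![a, b, c, c, c, c, c] i) • LinearMap.proj i

theorem scale_coord (a b c : ℤ) (x : L) (i : Fin 7) :
    scale a b c x i = ![a, b, c, c, c, c, c] i * x i := rfl

/-- If M is the matrix of C, G = `gram` and D is the Gram matrix of the columns, then MᵀGM = D
inverts to MD⁻¹Mᵀ = G⁻¹. The identity is entry (i, j) of this, multiplied by 6q to clear
denominators. -/
theorem gram_identity_of_columns {q : ℤ} (hq : q ≠ 0) (C : L →ₗ[ℤ] L)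
    (hC : ∀ x y, form (C x) (C y) = -2 * q * (x 0 * y 0) + 2 * (x 1 * y 1) + x 2 * y 3 + x 3 * y 2
      + x 4 * y 5 + x 5 * y 4 - 6 * (x 6 * y 6)) (i j : Fin 7) :
    3 * q * (C (Pi.single 1 1) i * C (Pi.single 1 1) j)
      - 3 * (C (Pi.single 0 1) i * C (Pi.single 0 1) j)
      + 6 * q * (C (Pi.single 2 1) i * C (Pi.single 3 1) j
        + C (Pi.single 3 1) i * C (Pi.single 2 1) j + C (Pi.single 4 1) i * C (Pi.single 5 1) j
        + C (Pi.single 5 1) i * C (Pi.single 4 1) j)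
      - q * (C (Pi.single 6 1) i * C (Pi.single 6 1) j) = q * gramCofactor i j := by
  set M := LinearMap.toMatrix' C with hM
  let D : Matrix (Fin 7) (Fin 7) ℤ :=
    !![-2 * q, 0, 0, 0, 0, 0, 0;
       0, 2, 0, 0, 0, 0, 0;
       0, 0, 0, 1, 0, 0, 0;
       0, 0, 1, 0, 0, 0, 0;
       0, 0, 0, 0, 0, 1, 0;
       0, 0, 0, 0, 1, 0, 0;
       0, 0, 0, 0, 0, 0, -6]
  let D' : Matrix (Fin 7) (Fin 7) ℤ :=
    !![-3, 0, 0, 0, 0, 0, 0;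
       0, 3 * q, 0, 0, 0, 0, 0;
       0, 0, 0, 6 * q, 0, 0, 0;
       0, 0, 6 * q, 0, 0, 0, 0;
       0, 0, 0, 0, 0, 6 * q, 0;
       0, 0, 0, 0, 6 * q, 0, 0;
       0, 0, 0, 0, 0, 0, -q]
  have h1 : M.transpose * gram * M = D := by
    refine transpose_toMatrix_mul_gram C D fun x y => ?_
    rw [hC]
    simp [D, Matrix.toBilin'_apply, Fin.sum_univ_succ]
    ring
  have h2 : D * D' = (6 * q) • 1 := by
    ext i j
    fin_cases i <;> fin_cases j <;>
      simp [D, D', Matrix.mul_apply, Fin.sum_univ_succ] <;> ring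
  have h3 : (M.transpose * gram) * (M * D') = (6 * q) • 1 := by
    rw [← mul_assoc, h1, h2]
  have h4 := mul_eq_smul_one_comm (mul_ne_zero (by norm_num) hq) h3
  have h5 : M * D' * M.transpose = q • gramCofactor := by
    have h6 := congrArg (· * gramCofactor) h4
    simp only [Matrix.mul_assoc, gram_mul_gramCofactor] at h6
    rw [Matrix.mul_smul, Matrix.mul_smul, Matrix.mul_smul, Matrix.mul_one, Matrix.smul_mul,
      Matrix.one_mul, mul_smul] at h6
    have := smul_right_injective _ (by norm_num : (6 : ℤ) ≠ 0) h6
    rw [← this, Matrix.mul_assoc]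
  have h6 := congrFun (congrFun h5 i) j
  have hcol : ∀ a b, M a b = C (Pi.single b 1) a := fun a b => by
    rw [hM, LinearMap.toMatrix'_apply]
  rw [Matrix.smul_apply, smul_eq_mul] at h6
  rw [← h6]
  simp [D', Matrix.mul_apply, Fin.sum_univ_succ, hcol]
  ring

/-- The rows (kᵢ, bᵢ, cᵢ) are orthogonal modulo 2, apart from the pair (6, 6), which leaves two
possible residues for b. One is that of k; the other makes every bᵢ with i ≠ 6 even, which (b, b) =
-2 excludes modulo 4. -/
theorem parity_of_gram_identity (b c k : L) (hk0 : k 0 = 1) (hk1 : k 1 = 1)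
    (hk : ∀ i, i ≠ 0 → i ≠ 1 → k i = 0) (hb : form b b = -2)
    (h : ∀ i j : Fin 7, j ≠ 6 → (2 : ℤ) ∣ k i * k j + b i * b j + c i * c j) (i : Fin 7) :
    (2 : ℤ) ∣ k i + b i := by
  have hz : ∀ i j : Fin 7, j ≠ 6 → (k i : ZMod 2) * k j + b i * b j + c i * c j = 0 := by
    intro i j hj
    have := (ZMod.intCast_zmod_eq_zero_iff_dvd _ 2).2 (h i j hj)
    push_cast at this
    exact this
  have hkz : ∀ i, i ≠ 0 → i ≠ 1 → (k i : ZMod 2) = 0 := fun i h0 h1 => by simp [hk i h0 h1]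
  have h00 := hz 0 0 (by decide)
  have h10 := hz 1 0 (by decide)
  have h11 := hz 1 1 (by decide)
  rw [hk0] at h00 h10
  rw [hk1] at h10 h11
  -- Here bᵢ ≡ cᵢ and bᵢ(b₀ + c₀) ≡ 0, while row 0 gives b₀ + c₀ ≡ 1.
  have claim : ∀ i : Fin 7, i ≠ 0 → i ≠ 1 → i ≠ 6 → (b i : ZMod 2) = 0 := by
    intro i hi0 hi1 hi6
    have e1 := hz i i hi6
    have e2 := hz i 0 (by decide)
    rw [hkz i hi0 hi1] at e1 e2
    generalize (b i : ZMod 2) = bi at *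
    generalize (c i : ZMod 2) = ci at *
    generalize (b 0 : ZMod 2) = b0 at *
    generalize (c 0 : ZMod 2) = c0 at *
    clear h10 h11 hz hkz h
    rw [hk0] at e2
    revert bi ci b0 c0
    decide
  have h60 := hz 6 0 (by decide)
  rw [hkz 6 (by decide) (by decide), zero_mul] at h60
  have cases : (b 0 : ZMod 2) = 1 ∧ (b 1 : ZMod 2) = 1 ∧ (b 6 : ZMod 2) = 0 ∨
      (b 0 : ZMod 2) = 0 ∧ (b 1 : ZMod 2) = 0 := by
    clear claim hkz hz
    generalize (b 6 : ZMod 2) = b6 at *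
    generalize (c 6 : ZMod 2) = c6 at *
    generalize (b 0 : ZMod 2) = b0 at *
    generalize (c 0 : ZMod 2) = c0 at *
    generalize (b 1 : ZMod 2) = b1 at *
    generalize (c 1 : ZMod 2) = c1 at *
    clear h
    revert b0 c0 b1 c1 b6 c6
    decide
  rcases cases with ⟨hb0, hb1, hb6⟩ | ⟨hb0, hb1⟩
  · rw [← Nat.cast_two, ← ZMod.intCast_zmod_eq_zero_iff_dvd]
    push_cast
    by_cases h0 : i = 0
    · subst h0; rw [hk0, hb0]; decide
    by_cases h1 : i = 1
    · subst h1; rw [hk1, hb1]; decide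
    rw [hkz i h0 h1, zero_add]
    by_cases h6 : i = 6
    · rw [h6, hb6]
    · exact claim i h0 h1 h6
  · exfalso
    have ev : ∀ i : Fin 7, i ≠ 6 → ∃ t, b i = 2 * t := by
      intro i h6
      apply (ZMod.intCast_zmod_eq_zero_iff_dvd _ 2).1
      by_cases h0 : i = 0
      · rw [h0, hb0]
      by_cases h1 : i = 1
      · rw [h1, hb1]
      exact claim i h0 h1 h6
    obtain ⟨t0, ht0⟩ := ev 0 (by decide)
    obtain ⟨t1, ht1⟩ := ev 1 (by decide)
    obtain ⟨t2, ht2⟩ := ev 2 (by decide)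
    obtain ⟨t3, ht3⟩ := ev 3 (by decide)
    obtain ⟨t4, ht4⟩ := ev 4 (by decide)
    obtain ⟨t5, ht5⟩ := ev 5 (by decide)
    rw [form_apply, ht0, ht1, ht2, ht3, ht4, ht5] at hb
    -- Impossible modulo 4: it would require 3b₆² ≡ 1, but 3b₆² is 0 or 3.
    have h8 : 4 * (t0 * t1 + t2 * t3 + t4 * t5) - 3 * (b 6 * b 6) = -1 := by linarith
    generalize t0 * t1 + t2 * t3 + t4 * t5 = s at h8
    rcases Int.even_or_odd' (b 6) with ⟨u, hu | hu⟩ <;> rw [hu] at h8 <;> ring_nf at h8 <;> omega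

theorem inv_apply_apply (g : L ≃ₗ[ℤ] L) (x : L) : g⁻¹ (g x) = x := g.symm_apply_apply x

theorem apply_inv_apply (g : L ≃ₗ[ℤ] L) (x : L) : g (g⁻¹ x) = x := g.apply_symm_apply x

/-- An embedding of the orthogonal complement of `e₁ + p² f₁` into that of `e₁ + f₁`, precomposed
with a projection `χ`, is the standard one `e₁ - p² f₁ ↦ p (e₁ - f₁)` up to an isometry fixing
`e₁ + f₁`. -/
theorem exists_isometry_of_standard_embedding {p : ℕ} (hp : p.Prime) (hp3 : 3 < p)
    (χ : L →ₗ[ℤ] L) (hχ1 : χ (Pi.single 1 1) = 0)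
    (hχk : ∀ x, form (standardVector 1) (χ x) = 0)
    (hχ : ∀ x y, form (χ x) (χ y) = -2 * (p : ℤ) ^ 2 * (x 0 * y 0) + x 2 * y 3 + x 3 * y 2
      + x 4 * y 5 + x 5 * y 4 - 6 * (x 6 * y 6)) :
    ∃ g ∈ orthogonalGroup, g (standardVector 1) = standardVector 1 ∧
      ∀ x, form (standardVector (p ^ 2)) x = 0 → g (scale (p ^ 2) 1 p x) = (p : ℤ) • χ x := by
  have hpZ : Prime (p : ℤ) := Nat.prime_iff_prime_int.1 hp
  have hp0 : (p : ℤ) ≠ 0 := hpZ.ne_zero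
  have hq : (p : ℤ) ^ 2 ≠ 0 := pow_ne_zero _ hp0
  set k := standardVector 1 with hk
  have hχk' : ∀ x, form (χ x) k = 0 := fun x => by rw [form_comm, hχk]
  have hkk : form k k = 2 := by
    rw [hk, form_standardVector]; simp [standardVector]
  -- Sending f₁ to k, instead of to 0 as χ does, gives a map of full rank, with Gram matrix
  -- diag(-2p², 2) ⊕ U ⊕ U ⊕ ⟨-6⟩.
  have gramId := gram_identity_of_columns hq (χ + (LinearMap.proj 1).smulRight k) (by
    intro x y
    simp only [LinearMap.add_apply, LinearMap.smulRight_apply, LinearMap.proj_apply, map_add,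
      map_smul, LinearMap.smul_apply, hχ, hχk, hχk', hkk, smul_eq_mul]
    ring)
  simp [hχ1] at gramId
  -- Modulo p only 3χ(e₁)ᵢ² survives on the diagonal of the identity, and p does not divide 3.
  have hdvd : ∀ i, (p : ℤ) ∣ χ (Pi.single 0 1) i := by
    intro i
    have h2 : (p : ℤ) ∣ 3 * (χ (Pi.single 0 1) i * χ (Pi.single 0 1) i) := by
      refine ⟨p * (3 * (k i * k i) + 6 * (χ (Pi.single 2 1) i * χ (Pi.single 3 1) i
        + χ (Pi.single 3 1) i * χ (Pi.single 2 1) i + χ (Pi.single 4 1) i * χ (Pi.single 5 1) i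
        + χ (Pi.single 5 1) i * χ (Pi.single 4 1) i)
        - χ (Pi.single 6 1) i * χ (Pi.single 6 1) i - gramCofactor i i), ?_⟩
      linear_combination -gramId i i
    rcases hpZ.dvd_or_dvd h2 with h3 | h3
    · have := Int.le_of_dvd (by norm_num) h3
      omega
    · exact (hpZ.dvd_or_dvd h3).elim id id
  choose b hb using hdvd
  have hχ0 : χ (Pi.single 0 1) = (p : ℤ) • b := funext hb
  have hbb : form b b = -2 := by
    have h1 := hχ (Pi.single 0 1) (Pi.single 0 1)
    rw [hχ0, map_smul, LinearMap.map_smul₂] at h1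
    simp at h1
    apply mul_left_cancel₀ hq
    linear_combination h1
  have hkb : form k b = 0 := by
    have h1 := hχk (Pi.single 0 1)
    rw [hχ0, map_smul, smul_eq_mul] at h1
    exact (mul_eq_zero.1 h1).resolve_left hp0
  have hχb : ∀ x, x 0 = 0 → form b (χ x) = 0 := by
    intro x hx
    have h1 := hχ (Pi.single 0 1) x
    rw [hχ0, LinearMap.map_smul₂] at h1
    simp [hx] at h1
    exact h1.resolve_left hp.ne_zero
  have hcof : ∀ i j : Fin 7, j ≠ 6 → (2 : ℤ) ∣ gramCofactor i j := by
    intro i j hj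
    fin_cases i <;> fin_cases j <;> simp [gramCofactor] at hj ⊢
  -- Dividing the identity by p² and reducing modulo 2 gives the hypothesis on rows; the result
  -- makes s = (k + b)/2 integral.
  have hpar := parity_of_gram_identity b (χ (Pi.single 6 1)) k (by simp [hk, standardVector])
    (by simp [hk, standardVector])
    (by intro i; fin_cases i <;> simp [hk, standardVector]) hbb (by
      intro i j hj
      have h1 := gramId i j
      rw [hb i, hb j] at h1
      have h2 : k i * k j + b i * b j + χ (Pi.single 6 1) i * χ (Pi.single 6 1) j
          = 4 * (k i * k j) - 2 * (b i * b j) + 6 * (χ (Pi.single 2 1) i * χ (Pi.single 3 1) j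
            + χ (Pi.single 3 1) i * χ (Pi.single 2 1) j + χ (Pi.single 4 1) i * χ (Pi.single 5 1) j
            + χ (Pi.single 5 1) i * χ (Pi.single 4 1) j) - gramCofactor i j := by
        apply mul_left_cancel₀ hq
        linear_combination -h1
      rw [h2]
      refine dvd_sub (dvd_add (dvd_sub ?_ ?_) ?_) (hcof i j hj) <;> apply Dvd.dvd.mul_right <;>
        norm_num)
  choose s hs using hpar
  have hs2 : k + b = (2 : ℤ) • s := funext hs
  have hks : form k s = 1 := by
    have h1 := congrArg (form k) hs2
    simp [-zsmul_eq_mul, hkk, hkb] at h1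
    omega
  have hss : form s s = 0 := by
    have h1 := congrArg₂ (fun u v => form u v) hs2 hs2
    simp [-zsmul_eq_mul, hkk, hkb, hbb, form_comm b k] at h1
    omega
  have hχs : ∀ x, x 0 = 0 → form s (χ x) = 0 := by
    intro x hx
    have h1 := congrArg (fun u => form u (χ x)) hs2
    simp [-zsmul_eq_mul, hχk, hχb x hx] at h1
    omega
  -- The vectors s and k - s span a hyperbolic plane orthogonal to the remaining columns of χ, so e₁
  -- ↦ s, f₁ ↦ k - s extends to an isometry; it sends e₁ + f₁ to k and e₁ - f₁ to b.
  let f : L →ₗ[ℤ] L := χ ∘ₗ scale 0 0 1 + (LinearMap.proj 0).smulRight s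
    + (LinearMap.proj 1).smulRight (k - s)
  have hf : ∀ x, f x = χ (scale 0 0 1 x) + x 0 • s + x 1 • (k - s) := fun x => rfl
  have hsc : ∀ x, scale 0 0 1 x 0 = 0 := fun x => by simp [scale_coord]
  have hχs' : ∀ x, form (χ (scale 0 0 1 x)) s = 0 := fun x => by
    rw [form_comm, hχs _ (hsc x)]
  obtain ⟨g, hg, hgf⟩ := exists_mem_orthogonalGroup f (by
    intro x y
    rw [hf, hf]
    simp only [map_add, map_sub, map_smul, LinearMap.add_apply, LinearMap.sub_apply,
      LinearMap.smul_apply, smul_eq_mul, hss, hks, hkk, hχk, hχk', hχs _ (hsc _), hχs',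
      form_comm s k, hχ]
    rw [form_apply]
    simp [scale_coord]
    ring)
  refine ⟨g, hg, ?_, ?_⟩
  · rw [hgf, hf]
    have : scale 0 0 1 k = 0 := by
      ext i; fin_cases i <;> simp [scale_coord, hk, standardVector]
    rw [this]
    simp [hk, standardVector]
  · intro x hx
    rw [form_standardVector] at hx
    have h1 : scale 0 0 1 (scale (p ^ 2) 1 p x) = (p : ℤ) • scale 0 0 1 x := by
      ext i; fin_cases i <;> simp [scale_coord]
    have h2 : x = x 0 • Pi.single 0 1 + x 1 • Pi.single 1 1 + scale 0 0 1 x := by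
      ext i; fin_cases i <;> simp [scale_coord]
    have h3 : χ x = x 0 • (p : ℤ) • b + χ (scale 0 0 1 x) := by
      conv_lhs => rw [h2]
      simp [-zsmul_eq_mul, hχ0, hχ1]
    rw [hgf, hf, h1, h3, map_smul, eq_sub_of_add_eq' hs2]
    ext i
    simp [scale_coord]
    rw [eq_neg_of_add_eq_zero_left hx]
    ring

/-- As (e₁ + p²f₁, f₁) = 1, L is the direct sum of ℤf₁ and the complement of e₁ + p²f₁. Projecting
along f₁ extends φ to an endomorphism of L, to which `exists_isometry_of_standard_embedding`
applies. -/
theorem exists_normal_form {p : ℕ} (hp : p.Prime) (hp3 : 3 < p) {h k : L}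
    (h_split : IsSplit h) (h_deg : form h h = 2 * (p : ℤ) ^ 2)
    (k_split : IsSplit k) (k_deg : form k k = 2)
    (φ : perp h →ₗ[ℤ] perp k) (hφ : IsLatticeEmbedding φ) :
    ∃ α ∈ orthogonalGroup, ∃ γ ∈ orthogonalGroup, α (standardVector (p ^ 2)) = h ∧
      γ (standardVector 1) = k ∧
      ∀ m : perp h, γ (scale (p ^ 2) 1 p (α⁻¹ m)) = (p : ℤ) • (φ m : L) := by
  obtain ⟨α, hα, hαh⟩ := sameOrbit_standardVector h_split h_deg
  obtain ⟨β, hβ, hβk⟩ := sameOrbit_standardVector k_split (d := 1) k_deg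
  have hβi := inv_mem hβ
  let P : L →ₗ[ℤ] L :=
    LinearMap.id - (form (standardVector (p ^ 2))).smulRight (Pi.single 1 1)
  have hP : ∀ x, P x = x - form (standardVector (p ^ 2)) x • Pi.single 1 1 := fun x => rfl
  have hPperp : ∀ x, form (standardVector (p ^ 2)) (P x) = 0 := by
    intro x
    rw [hP, form_standardVector, form_standardVector]
    simp
  let q : L →ₗ[ℤ] perp h := (α.toLinearMap ∘ₗ P).codRestrict (perp h) fun x => by
    rw [perp, LinearMap.mem_ker, ← hαh]
    exact (hα _ _).trans (hPperp x)
  have hq : ∀ x, (q x : L) = α (P x) := fun x => rfl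
  let χ : L →ₗ[ℤ] L := (β⁻¹).toLinearMap ∘ₗ (perp k).subtype ∘ₗ φ ∘ₗ q
  have hχ : ∀ x, χ x = β⁻¹ (φ (q x) : L) := fun x => rfl
  obtain ⟨g, hg, hgk, hgχ⟩ := exists_isometry_of_standard_embedding hp hp3 χ
    (by
      have : P (Pi.single 1 1) = 0 := by
        rw [hP, form_standardVector]; simp
      have : q (Pi.single 1 1) = 0 := Subtype.ext (by rw [hq, this]; simp)
      rw [hχ, this]; simp)
    (by
      intro x
      rw [hχ, ← hβ, apply_inv_apply, hβk]
      exact LinearMap.mem_ker.1 (φ (q x)).2)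
    (by
      intro x y
      rw [hχ, hχ, hβi, hφ.2, hq, hq, hα, hP, hP, form_standardVector, form_standardVector,
        form_apply]
      simp
      ring)
  refine ⟨α, hα, β * g, mul_mem hβ hg, hαh, ?_, ?_⟩
  · rw [LinearEquiv.mul_apply, hgk, hβk]
  · intro m
    have h1 : form (standardVector (p ^ 2)) (α⁻¹ m) = 0 := by
      rw [← hα, apply_inv_apply, hαh]
      exact LinearMap.mem_ker.1 m.2
    have h2 : q (α⁻¹ m) = m := Subtype.ext (by
      rw [hq, hP, h1, zero_smul, sub_zero, apply_inv_apply])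
    rw [LinearEquiv.mul_apply, hgχ _ h1, map_smul, hχ, apply_inv_apply, h2]

theorem exists_latticeEmbedding (p : ℕ) (hp : p ≠ 0) {h k : L}
    (h_split : IsSplit h) (h_deg : form h h = 2 * (p : ℤ) ^ 2)
    (k_split : IsSplit k) (k_deg : form k k = 2) :
    ∃ φ : perp h →ₗ[ℤ] perp k, IsLatticeEmbedding φ := by
  obtain ⟨α, hα, hαh⟩ := sameOrbit_standardVector h_split h_deg
  obtain ⟨β, hβ, hβk⟩ := sameOrbit_standardVector k_split (d := 1) k_deg
  -- On the complement of e₁ + p²f₁ this is e₁ - p²f₁ ↦ p(e₁ - f₁), with the other coordinates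
  -- unchanged.
  let f : L →ₗ[ℤ] L := scale p 0 1 - (LinearMap.proj 0).smulRight (Pi.single 1 (p : ℤ))
  have hf : ∀ x, f x = scale p 0 1 x - x 0 • Pi.single 1 (p : ℤ) := fun x => rfl
  have hx : ∀ m : perp h, (α⁻¹ (m : L)) 1 = -(p ^ 2 * (α⁻¹ (m : L)) 0) := by
    intro m
    apply eq_neg_of_add_eq_zero_left
    rw [← form_standardVector, ← hα, apply_inv_apply, hαh]
    exact LinearMap.mem_ker.1 m.2
  let φ : perp h →ₗ[ℤ] perp k :=
    (β.toLinearMap ∘ₗ f ∘ₗ (α⁻¹).toLinearMap ∘ₗ (perp h).subtype).codRestrict (perp k) fun m => by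
      rw [perp, LinearMap.mem_ker, ← hβk]
      refine (hβ _ _).trans ?_
      rw [form_standardVector]
      simp [hf, scale_coord]
      ring
  have hφ : ∀ m : perp h, (φ m : L) = β (f (α⁻¹ m)) := fun m => rfl
  refine ⟨φ, (injective_iff_map_eq_zero φ).2 fun m hm => ?_, fun x y => ?_⟩
  · have h1 : f (α⁻¹ (m : L)) = 0 := by
      rw [← inv_apply_apply β (f _), ← hφ, hm]; simp
    have h2 : α⁻¹ (m : L) = 0 := by
      have h3 : (α⁻¹ (m : L)) 0 = 0 := by
        have := congrFun h1 0
        simpa [hf, scale_coord, hp] using this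
      have h4 : (α⁻¹ (m : L)) 1 = 0 := by rw [hx, h3]; simp
      ext i
      have := congrFun h1 i
      fin_cases i
      exacts [h3, h4, by simpa [hf, scale_coord] using this, by simpa [hf, scale_coord] using this,
        by simpa [hf, scale_coord] using this, by simpa [hf, scale_coord] using this,
        by simpa [hf, scale_coord] using this]
    exact Subtype.ext (by rw [← apply_inv_apply α m, h2]; simp)
  · rw [hφ, hφ, hβ, ← inv_mem hα (x : L), form_apply, form_apply, hx, hx]
    simp [hf, scale_coord]
    ring

/-! ### Similarities, spinor norms and conjugation -/

theorem formR_toReal (x y : L) : formR (toReal x) (toReal y) = (form x y : ℝ) := by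
  rw [form_apply]
  simp [formR, Matrix.toBilin'_apply, gram, Fin.sum_univ_succ, toReal]
  ring

/-- The real extension of an endomorphism of `L`. -/
noncomputable def extendReal (f : L →ₗ[ℤ] L) : LR →ₗ[ℝ] LR :=
  Matrix.toLin' ((LinearMap.toMatrix' f).map (Int.cast : ℤ → ℝ))

theorem extendReal_toReal (f : L →ₗ[ℤ] L) (x : L) :
    extendReal f (toReal x) = toReal (f x) := by
  ext i
  rw [extendReal, Matrix.toLin'_apply]
  conv_rhs => rw [← Matrix.toLin'_toMatrix' f, Matrix.toLin'_apply]
  exact (RingHom.map_mulVec (Int.castRingHom ℝ) (LinearMap.toMatrix' f) x i).symm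

theorem toReal_single (i : Fin 7) : toReal (Pi.single i 1) = Pi.single i 1 := by
  ext j
  simp [toReal, Pi.single_apply]

theorem toReal_smul (n : ℤ) (x : L) : toReal (n • x) = (n : ℝ) • toReal x := by
  ext j
  simp [toReal]

theorem formR_extendReal {f : L →ₗ[ℤ] L} {n : ℤ} (hf : ∀ x y, form (f x) (f y) = n * form x y)
    (x y : LR) : formR (extendReal f x) (extendReal f y) = n * formR x y := by
  have : formR.comp (extendReal f) (extendReal f) = (n : ℝ) • formR := by
    refine LinearMap.BilinForm.ext_basis (Pi.basisFun ℝ (Fin 7)) fun i j => ?_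
    simp only [Pi.basisFun_apply, LinearMap.BilinForm.comp_apply, LinearMap.smul_apply, smul_eq_mul]
    rw [← toReal_single, ← toReal_single, extendReal_toReal, extendReal_toReal, formR_toReal, hf,
      formR_toReal]
    push_cast
    rfl
  exact congrFun (congrArg DFunLike.coe (congrFun (congrArg DFunLike.coe this) x)) y

/-- `f` and `f'` multiply the form by `n` and are inverse to each other up to the factor `n`. -/
structure IsSimilarityPair (n : ℤ) (f f' : L →ₗ[ℤ] L) : Prop where
  form_left : ∀ x y, form (f x) (f y) = n * form x y
  form_right : ∀ x y, form (f' x) (f' y) = n * form x y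
  left_right : ∀ x, f (f' x) = n • x
  right_left : ∀ x, f' (f x) = n • x

theorem IsSimilarityPair.symm {n : ℤ} {f f' : L →ₗ[ℤ] L} (h : IsSimilarityPair n f f') :
    IsSimilarityPair n f' f :=
  ⟨h.form_right, h.form_left, h.right_left, h.left_right⟩

theorem reflection_extendReal {f : L →ₗ[ℤ] L} {n : ℤ} (hn : n ≠ 0)
    (hf : ∀ x y, form (f x) (f y) = n * form x y) (v x : LR) :
    reflection (extendReal f v) (extendReal f x) = extendReal f (reflection v x) := by
  have hn' : (n : ℝ) ≠ 0 := Int.cast_ne_zero.2 hn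
  rw [reflection_apply, reflection_apply, map_sub, map_smul, formR_extendReal hf,
    formR_extendReal hf]
  congr 2
  -- For isotropic `v` both coefficients vanish, since division by zero gives zero.
  by_cases h : formR v v = 0
  · simp [h]
  · field_simp

/-- Conjugation by f turns the reflection in v into the reflection in f(v), and multiplies each
factor of the spinor norm by n > 0. -/
theorem HasSpinorNormOne.of_intertwined {n : ℤ} (hn : 0 < n) {f f' : L →ₗ[ℤ] L}
    (hf : IsSimilarityPair n f f') {g g' : L ≃ₗ[ℤ] L} (hg : ∀ x, g' (f x) = f (g x))
    (h : HasSpinorNormOne g) : HasSpinorNormOne g' := by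
  obtain ⟨vs, hvs, hprod, hpos⟩ := h
  have hnR : (0 : ℝ) < n := Int.cast_pos.2 hn
  refine ⟨vs.map (extendReal f), ?_, ?_, ?_⟩
  · intro v hv
    obtain ⟨u, hu, rfl⟩ := List.mem_map.1 hv
    rw [formR_extendReal hf.form_left]
    exact mul_ne_zero hnR.ne' (hvs u hu)
  · have key : ∀ (us : List LR) (x : LR), ((us.map (extendReal f)).map reflection).prod
        (extendReal f x) = extendReal f ((us.map reflection).prod x) := by
      intro us
      induction us with
      | nil => intro x; rfl
      | cons u us ih =>
        intro x
        simp only [List.map_cons, List.prod_cons, Module.End.mul_apply]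
        rw [ih, reflection_extendReal hn.ne' hf.form_left]
    intro x
    have h1 := key vs (toReal (f' x))
    rw [hprod, extendReal_toReal, extendReal_toReal, ← hg, hf.left_right, map_smul, toReal_smul,
      toReal_smul, map_smul] at h1
    exact smul_right_injective _ hnR.ne' h1
  · have key : ∀ us : List LR, 0 < (us.map fun v => -formR v v / 2).prod →
        0 < ((us.map (extendReal f)).map fun v => -formR v v / 2).prod := by
      intro us hus
      rw [List.map_map]
      have : (us.map ((fun v => -formR v v / 2) ∘ extendReal f)).prod
          = (n : ℝ) ^ us.length * (us.map fun v => -formR v v / 2).prod := by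
        clear hus
        induction us with
        | nil => simp
        | cons u us ih =>
          simp only [List.map_cons, List.prod_cons, ih, Function.comp_apply, List.length_cons,
            formR_extendReal hf.form_left]
          ring
      rw [this]
      exact mul_pos (pow_pos hnR _) hus
    exact key vs hpos

theorem IsSimilarityPair.eq_of_intertwined {n : ℤ} (hn : n ≠ 0) {f f' : L →ₗ[ℤ] L}
    (hf : IsSimilarityPair n f f') {a b : L ≃ₗ[ℤ] L} (h : ∀ x, a (f x) = b (f x)) : a = b := by
  refine LinearEquiv.ext fun y => smul_right_injective _ hn ?_
  change n • a y = n • b y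
  rw [← map_smul, ← map_smul, ← hf.left_right, h]

theorem IsSimilarityPair.intertwined_symm {n : ℤ} (hn : n ≠ 0) {f f' : L →ₗ[ℤ] L}
    (hf : IsSimilarityPair n f f') {a b : L ≃ₗ[ℤ] L} (h : ∀ x, b (f x) = f (a x)) (y : L) :
    a (f' y) = f' (b y) := by
  refine smul_right_injective _ hn ?_
  change n • _ = n • _
  rw [← hf.right_left, ← h, hf.left_right, map_smul, map_smul]

/-- The conjugate of g by f is f g f' / n, so integrality is the only obstruction; `hdiv` supplies
it. -/
theorem IsSimilarityPair.exists_stabPlus_intertwined {n : ℤ} (hn : 0 < n) {f f' : L →ₗ[ℤ] L}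
    (hf : IsSimilarityPair n f f') {h k : L} {c : ℤ} (hc : c ≠ 0) (hfh : f h = c • k)
    (g : stabPlus h) (hdiv : ∀ y, ∃ z, f (g.1 (f' y)) = n • z) :
    ∃ g' : stabPlus k, ∀ x, g'.1 (f x) = f (g.1 x) := by
  choose z hz using hdiv
  have inj := smul_right_injective L hn.ne'
  let G : L →ₗ[ℤ] L :=
    { toFun := z
      map_add' := fun x y => inj (by
        change n • _ = n • _
        rw [← hz, smul_add, ← hz, ← hz, map_add, map_add, map_add])
      map_smul' := fun m x => inj (by
        change n • _ = n • (m • _)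
        rw [← hz, smul_comm, ← hz, map_smul, map_smul, map_smul]) }
  have hG : ∀ y, n • G y = f (g.1 (f' y)) := fun y => (hz y).symm
  obtain ⟨g', hg', hgG⟩ := exists_mem_orthogonalGroup G (by
    intro x y
    have h1 : form (n • G x) (n • G y) = n * (n * form x y) := by
      rw [hG, hG, hf.form_left, g.2.1.1, hf.form_right]
    rw [map_smul, LinearMap.map_smul₂, smul_eq_mul, smul_eq_mul] at h1
    exact mul_left_cancel₀ hn.ne' (mul_left_cancel₀ hn.ne' h1))
  have hint : ∀ x, g' (f x) = f (g.1 x) := fun x => inj (by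
    change n • _ = n • _
    rw [hgG, hG, hf.right_left, map_smul, map_smul])
  refine ⟨⟨g', ⟨hg', g.2.1.2.of_intertwined hn hf hint⟩, ?_⟩, hint⟩
  have h1 := hint h
  rw [g.2.2, hfh, map_smul] at h1
  exact smul_right_injective L hc h1

/-! ### Integrality of conjugates by the diagonal similarity -/

theorem isSimilarityPair_scale (p : ℤ) :
    IsSimilarityPair (p ^ 2) (scale (p ^ 2) 1 p) (scale 1 (p ^ 2) p) where
  form_left x y := by
    rw [form_apply, form_apply]; simp [scale_coord]; ring
  form_right x y := by
    rw [form_apply, form_apply]; simp [scale_coord]; ring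
  left_right x := by
    ext i; fin_cases i <;> simp [scale_coord] <;> ring
  right_left x := by
    ext i; fin_cases i <;> simp [scale_coord] <;> ring

theorem IsSimilarityPair.conj {n : ℤ} {f f' : L →ₗ[ℤ] L} (hf : IsSimilarityPair n f f')
    {a c : L ≃ₗ[ℤ] L} (ha : a ∈ orthogonalGroup) (hc : c ∈ orthogonalGroup) :
    IsSimilarityPair n (c.toLinearMap ∘ₗ f ∘ₗ (a⁻¹).toLinearMap)
      (a.toLinearMap ∘ₗ f' ∘ₗ (c⁻¹).toLinearMap) where
  form_left x y := by
    refine (hc _ _).trans ((hf.form_left _ _).trans ?_)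
    exact congrArg (n * ·) (inv_mem ha x y)
  form_right x y := by
    refine (ha _ _).trans ((hf.form_right _ _).trans ?_)
    exact congrArg (n * ·) (inv_mem hc x y)
  left_right x := by
    change c (f (a⁻¹ (a (f' (c⁻¹ x))))) = _
    rw [inv_apply_apply, hf.left_right, map_smul, apply_inv_apply]
  right_left x := by
    change a (f' (c⁻¹ (c (f (a⁻¹ x))))) = _
    rw [inv_apply_apply, hf.right_left, map_smul, apply_inv_apply]

theorem exists_eq_smul_of_dvd {n : ℤ} {x : L} (h : ∀ i, n ∣ x i) : ∃ z, x = n • z := by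
  choose z hz using h
  exact ⟨z, funext hz⟩

theorem form_single_zero (x : L) : form (Pi.single 0 1) x = x 1 := by simp [form_apply]

theorem form_single_one (x : L) : form (Pi.single 1 1) x = x 0 := by simp [form_apply]

/-- Fixing e₁ + p²f₁ forces g(e₁) ≡ e₁ modulo p². The same for g⁻¹ controls coordinate 1 of g(r),
which is (g⁻¹e₁, r). -/
theorem scale_conj_dvd_of_fixes (p : ℤ) {g : L ≃ₗ[ℤ] L} (hg : g ∈ orthogonalGroup)
    (hgh : g (standardVector (p ^ 2)) = standardVector (p ^ 2)) (y : L) :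
    ∃ z, scale (p ^ 2) 1 p (g (scale 1 (p ^ 2) p y)) = p ^ 2 • z := by
  have hstd : standardVector (p ^ 2) = Pi.single 0 1 + p ^ 2 • Pi.single 1 1 := by
    ext i; fin_cases i <;> simp [standardVector]
  have hfix : ∀ g' : L ≃ₗ[ℤ] L, g' (standardVector (p ^ 2)) = standardVector (p ^ 2) →
      g' (Pi.single 0 1) = Pi.single 0 1 + p ^ 2 • (Pi.single 1 1 - g' (Pi.single 1 1)) := by
    intro g' h
    rw [hstd, map_add, map_smul] at h
    rw [smul_sub, add_sub, ← h, add_sub_cancel_right]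
  have hinv : g⁻¹ (standardVector (p ^ 2)) = standardVector (p ^ 2) := by
    conv_lhs => rw [← hgh]
    exact inv_apply_apply g _
  have hr : ∀ r : L, r 1 = 0 → p ^ 2 ∣ g r 1 := by
    intro r h1
    rw [← form_single_zero (g r), ← inv_mem hg, inv_apply_apply, hfix _ hinv, map_add,
      LinearMap.add_apply, form_single_zero, h1, zero_add, LinearMap.map_smul₂]
    exact ⟨_, rfl⟩
  have hdec : scale 1 (p ^ 2) p y = y 0 • Pi.single 0 1 + p • (p • y 1 • Pi.single 1 1
      + scale 0 0 1 y) := by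
    ext i; fin_cases i <;> simp [scale_coord]; ring
  have h0 : ∀ i, g (scale 1 (p ^ 2) p y) i = y 0 * ((Pi.single 0 1 : L) i
      + p ^ 2 * ((Pi.single 1 1 : L) i - g (Pi.single 1 1) i))
      + p * (p * (y 1 * g (Pi.single 1 1) i) + g (scale 0 0 1 y) i) := by
    intro i
    rw [hdec, map_add, map_smul, map_smul, map_add, map_smul, map_smul, hfix g hgh]
    rfl
  apply exists_eq_smul_of_dvd
  intro i
  rw [scale_coord, h0]
  by_cases hi0 : i = 0
  · subst hi0
    exact ⟨_, rfl⟩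
  by_cases hi1 : i = 1
  · subst hi1
    obtain ⟨t, ht⟩ := hr (scale 0 0 1 y) (by simp [scale_coord])
    rw [ht]
    refine ⟨y 0 * (1 - g (Pi.single 1 1) 1) + y 1 * g (Pi.single 1 1) 1 + p * t, ?_⟩
    simp
    ring
  · have : ![p ^ 2, 1, p, p, p, p, p] i = p := by fin_cases i <;> simp at hi0 hi1 ⊢
    rw [this, Pi.single_eq_of_ne hi0]
    exact ⟨y 0 * (p * ((Pi.single 1 1 : L) i - g (Pi.single 1 1) i))
      + (p * (y 1 * g (Pi.single 1 1) i) + g (scale 0 0 1 y) i), by ring⟩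

/-- The delicate entry is coordinate 0 of g(f₁) = f₁ + pu, which must vanish modulo p², not just p.
Fixing e₁ + f₁ gives u₀ + u₁ = 0, and then isotropy of g(f₁) gives p ∣ u₀. -/
theorem scale_conj_dvd_of_congr {p : ℤ} (hp : Prime p) {g : L ≃ₗ[ℤ] L}
    (hg : g ∈ orthogonalGroup) (hgk : g (standardVector 1) = standardVector 1)
    (hcong : ∃ u, g (Pi.single 1 1) = Pi.single 1 1 + p • u) (y : L) :
    ∃ z, scale 1 (p ^ 2) p (g (scale (p ^ 2) 1 p y)) = p ^ 2 • z := by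
  obtain ⟨u, hu⟩ := hcong
  have hinv : g⁻¹ (Pi.single 1 1) = Pi.single 1 1 - p • g⁻¹ u := by
    rw [← map_smul, ← sub_eq_of_eq_add' hu, map_sub, inv_apply_apply, sub_sub_cancel]
  have hr : ∀ r : L, r 0 = 0 → p ∣ g r 0 := by
    intro r h1
    rw [← form_single_one (g r), ← inv_mem hg, inv_apply_apply, hinv, map_sub, LinearMap.sub_apply,
      form_single_one, h1, zero_sub, LinearMap.map_smul₂, dvd_neg]
    exact ⟨_, rfl⟩
  have hu01 : u 0 + u 1 = 0 := by
    have h1 := hg (standardVector 1) (Pi.single 1 1)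
    rw [hgk, form_standardVector, form_standardVector, hu] at h1
    simp at h1
    have h2 : p * (u 0 + u 1) = 0 := by linarith
    exact (mul_eq_zero.1 h2).resolve_left hp.ne_zero
  have hu0 : p ∣ u 0 := by
    have h1 := hg (Pi.single 1 1) (Pi.single 1 1)
    rw [hu, form_apply, form_apply] at h1
    simp [-zsmul_eq_mul] at h1
    have h2 : p * (u 0 + p * (u 0 * u 1 + u 2 * u 3 + u 4 * u 5 - 3 * (u 6 * u 6))) = 0 := by
      linarith
    have h3 := (mul_eq_zero.1 h2).resolve_left hp.ne_zero
    exact ⟨_, (eq_neg_of_add_eq_zero_left h3).trans (mul_neg _ _).symm⟩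
  obtain ⟨t, ht⟩ := hu0
  have hdec : scale (p ^ 2) 1 p y = y 1 • Pi.single 1 1 + p • (p • y 0 • Pi.single 0 1
      + scale 0 0 1 y) := by
    ext i; fin_cases i <;> simp [scale_coord]; ring
  have h0 : ∀ i, g (scale (p ^ 2) 1 p y) i = y 1 * ((Pi.single 1 1 : L) i + p * u i)
      + p * (p * (y 0 * g (Pi.single 0 1) i) + g (scale 0 0 1 y) i) := by
    intro i
    rw [hdec, map_add, map_smul, map_smul, map_add, map_smul, map_smul, hu]
    rfl
  apply exists_eq_smul_of_dvd
  intro i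
  rw [scale_coord, h0]
  by_cases hi0 : i = 0
  · subst hi0
    obtain ⟨s, hs⟩ := hr (scale 0 0 1 y) (by simp [scale_coord])
    rw [hs, ht]
    refine ⟨y 1 * t + y 0 * g (Pi.single 0 1) 0 + s, ?_⟩
    simp
    ring
  by_cases hi1 : i = 1
  · subst hi1
    exact ⟨_, rfl⟩
  · have : ![1, p ^ 2, p, p, p, p, p] i = p := by fin_cases i <;> simp at hi0 hi1 ⊢
    rw [this, Pi.single_eq_of_ne hi1]
    exact ⟨y 1 * u i + (p * (y 0 * g (Pi.single 0 1) i) + g (scale 0 0 1 y) i), by ring⟩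

/-! ### Counting cosets by isotropic vectors modulo p -/

theorem _root_.Subgroup.finiteIndex_and_index_le_of_fiber {G V : Type*} [Group G]
    (H : Subgroup G) (F : G → V) (s : Finset V) (hF : ∀ g, F g ∈ s)
    (hfib : ∀ a b, F a = F b → a⁻¹ * b ∈ H) : H.FiniteIndex ∧ H.index ≤ s.card := by
  let E : G ⧸ H → s := fun q => ⟨F q.out, hF _⟩
  have hE : Function.Injective E := by
    intro q r h
    rw [← q.out_eq', ← r.out_eq']
    exact QuotientGroup.eq.2 (hfib _ _ (Subtype.ext_iff.1 h))
  have : Finite (G ⧸ H) := Finite.of_injective E hE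
  refine ⟨Subgroup.finiteIndex_of_finite_quotient, ?_⟩
  rw [Subgroup.index_eq_card]
  simpa using Nat.card_le_card_of_injective E hE

open Classical in
/-- The vectors of `L / p L` that are isotropic and have product `1` with `e₁ + f₁`. -/
noncomputable def isotropicModP (p : ℕ) [NeZero p] : Finset (Fin 7 → ZMod p) :=
  Finset.univ.filter fun v =>
    v 0 + v 1 = 1 ∧ v 0 * v 1 + v 2 * v 3 + v 4 * v 5 = 3 * (v 6 * v 6)

theorem card_isotropicModP_le {p : ℕ} [Fact p.Prime] (hp3 : 3 < p) :
    (isotropicModP p).card ≤ 2 * p ^ 5 := by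
  classical
  have h3 : (3 : ZMod p) ≠ 0 := by
    intro h
    have := (ZMod.natCast_eq_zero_iff 3 p).1 (by exact_mod_cast h)
    exact absurd (Nat.le_of_dvd (by norm_num) this) (by omega)
  have key := Finset.card_le_mul_card_image_of_maps_to (s := isotropicModP p)
    (t := (Finset.univ : Finset (Fin 5 → ZMod p)))
    (f := fun v => ![v 0, v 2, v 3, v 4, v 5]) (fun _ _ => Finset.mem_univ _) 2 (by
      intro b _
      rcases Finset.eq_empty_or_nonempty
        {a ∈ isotropicModP p | ![a 0, a 2, a 3, a 4, a 5] = b} with he | ⟨v, hv⟩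
      · rw [he]; simp
      -- The linear condition determines v₁ and the quadratic one determines v₆², as 3 is invertible
      -- modulo p.
      refine (Finset.card_le_card (t := {v, Function.update v 6 (-v 6)}) ?_).trans
        Finset.card_le_two
      intro w hw
      obtain ⟨hv, hvb⟩ := Finset.mem_filter.1 hv
      obtain ⟨hw, hwb⟩ := Finset.mem_filter.1 hw
      obtain ⟨-, hv1, hv2⟩ := Finset.mem_filter.1 hv
      obtain ⟨-, hw1, hw2⟩ := Finset.mem_filter.1 hw
      have hvw := hwb.trans hvb.symm
      have e0 : w 0 = v 0 := congrFun hvw 0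
      have e2 : w 2 = v 2 := congrFun hvw 1
      have e3 : w 3 = v 3 := congrFun hvw 2
      have e4 : w 4 = v 4 := congrFun hvw 3
      have e5 : w 5 = v 5 := congrFun hvw 4
      have e1 : w 1 = v 1 := by
        rw [e0, ← hv1] at hw1
        exact add_left_cancel hw1
      rw [e0, e1, e2, e3, e4, e5, hv2] at hw2
      rw [Finset.mem_insert, Finset.mem_singleton]
      rcases mul_self_eq_mul_self_iff.1 (mul_left_cancel₀ h3 hw2) with e6 | e6
      · left
        ext i; fin_cases i <;> simp [*]
      · right
        ext i; fin_cases i <;> simp [*])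
  simpa [ZMod.card] using key

theorem exists_hom_of_intertwined {n : ℤ} (hn : n ≠ 0) {f f' : L →ₗ[ℤ] L}
    (hf : IsSimilarityPair n f f') {h k : L}
    (hex : ∀ g : stabPlus h, ∃ g' : stabPlus k, ∀ x, g'.1 (f x) = f (g.1 x)) :
    ∃ ι : stabPlus h →* stabPlus k, (∀ g x, (ι g).1 (f x) = f (g.1 x)) ∧
      Function.Injective ι := by
  choose F hF using hex
  refine ⟨MonoidHom.mk' F fun a b => Subtype.ext (hf.eq_of_intertwined hn fun x => ?_), hF, ?_⟩
  · rw [hF]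
    change f (a.1 (b.1 x)) = (F a).1 ((F b).1 (f x))
    rw [hF, hF]
  · intro a b hab
    have hab' : F a = F b := hab
    refine Subtype.ext (hf.symm.eq_of_intertwined hn fun y => ?_)
    rw [hf.intertwined_symm hn (hF a), hab', hf.intertwined_symm hn (hF b)]

theorem mem_stabPlus_conj {h k : L} {c : L ≃ₗ[ℤ] L} (hc : c ∈ orthogonalGroup) (hch : c h = k)
    (g : stabPlus k) : c⁻¹ * g.1 * c ∈ orthogonalGroup ∧ (c⁻¹ * g.1 * c) h = h := by
  refine ⟨mul_mem (mul_mem (inv_mem hc) g.2.1.1) hc, ?_⟩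
  rw [LinearEquiv.mul_apply, LinearEquiv.mul_apply, hch, g.2.2, ← hch, inv_apply_apply]

theorem exists_hom_range_index_le {p : ℕ} (hp : p.Prime) (hp3 : 3 < p) {h k : L}
    (h_split : IsSplit h) (h_deg : form h h = 2 * (p : ℤ) ^ 2)
    (k_split : IsSplit k) (k_deg : form k k = 2)
    (φ : perp h →ₗ[ℤ] perp k) (hφ : IsLatticeEmbedding φ) :
    ∃ ι : stabPlus h →* stabPlus k,
      (∀ (g : stabPlus h) (x : perp h), actPerp (ι g) (φ x) = φ (actPerp g x)) ∧
      Function.Injective ι ∧ ι.range.FiniteIndex ∧ ι.range.index ≤ 2 * p ^ 5 := by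
  have : Fact p.Prime := ⟨hp⟩
  have hpZ : Prime (p : ℤ) := Nat.prime_iff_prime_int.1 hp
  have hq : (0 : ℤ) < (p : ℤ) ^ 2 := pow_pos (by exact_mod_cast hp.pos) 2
  obtain ⟨α, hα, γ, hγ, hαh, hγk, hφm⟩ :=
    exists_normal_form hp hp3 h_split h_deg k_split k_deg φ hφ
  have hpair := (isSimilarityPair_scale p).conj hα hγ
  set f := γ.toLinearMap ∘ₗ scale (p ^ 2) 1 p ∘ₗ (α⁻¹).toLinearMap with hf
  set f' := α.toLinearMap ∘ₗ scale 1 (p ^ 2) p ∘ₗ (γ⁻¹).toLinearMap with hf'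
  have hfx : ∀ x, f x = γ (scale (p ^ 2) 1 p (α⁻¹ x)) := fun x => rfl
  have hfx' : ∀ x, f' x = α (scale 1 (p ^ 2) p (γ⁻¹ x)) := fun x => rfl
  have hfh : f h = (p : ℤ) ^ 2 • k := by
    rw [hfx, ← hαh, inv_apply_apply, ← hγk, ← map_smul]
    congr 1
    ext i; fin_cases i <;> simp [scale_coord, standardVector]
  have hfk : f' k = (1 : ℤ) • h := by
    rw [hfx', ← hαh, ← hγk, inv_apply_apply, ← map_smul]
    congr 1
    ext i; fin_cases i <;> simp [scale_coord, standardVector]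
  obtain ⟨ι, hι, hinj⟩ := exists_hom_of_intertwined hq.ne' hpair
    (fun g => hpair.exists_stabPlus_intertwined hq hq.ne' hfh g fun y => by
      obtain ⟨hO, hfix⟩ := mem_stabPlus_conj hα hαh g
      obtain ⟨z, hz⟩ := scale_conj_dvd_of_fixes p hO hfix (γ⁻¹ y)
      exact ⟨γ z, by rw [hfx, hfx', ← map_smul, ← hz]; rfl⟩)
  refine ⟨ι, fun g x => Subtype.ext ?_, hinj, ?_⟩
  · refine smul_right_injective L hpZ.ne_zero ?_
    change (p : ℤ) • (ι g).1 (φ x : L) = (p : ℤ) • (φ (actPerp g x) : L)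
    rw [← map_smul, ← hφm, ← hφm]
    exact hι g x
  -- The coset invariant is the image of f₁ modulo p, in the coordinates given by γ.
  obtain ⟨hfin, hle⟩ := Subgroup.finiteIndex_and_index_le_of_fiber ι.range
    (fun g i => (((γ⁻¹ * g.1 * γ) (Pi.single 1 1) i : ℤ) : ZMod p)) (isotropicModP p)
    (by
      intro g
      obtain ⟨hO, hfix⟩ := mem_stabPlus_conj hγ hγk g
      generalize γ⁻¹ * g.1 * γ = c at hO hfix ⊢
      have h1 := hO (standardVector 1) (Pi.single 1 1)
      rw [hfix, form_standardVector, form_standardVector] at h1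
      have h2 := hO (Pi.single 1 1) (Pi.single 1 1)
      rw [form_apply, form_apply] at h2
      generalize c (Pi.single 1 1) = v at h1 h2
      simp at h1 h2
      refine Finset.mem_filter.2 ⟨Finset.mem_univ _, ?_, ?_⟩
      · beta_reduce
        rw [add_comm]
        exact_mod_cast congrArg (Int.cast : ℤ → ZMod p) h1
      · have h3 : v 0 * v 1 + v 2 * v 3 + v 4 * v 5 = 3 * (v 6 * v 6) := by linarith
        beta_reduce
        exact_mod_cast congrArg (Int.cast : ℤ → ZMod p) h3)
    (by
      intro a b hab
      have hdvd : ∀ i, (p : ℤ) ∣ ((γ⁻¹ * b.1 * γ) (Pi.single 1 1)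
          - (γ⁻¹ * a.1 * γ) (Pi.single 1 1)) i := fun i =>
        (ZMod.intCast_eq_intCast_iff_dvd_sub _ _ p).1 (congrFun hab i)
      obtain ⟨u, hu⟩ := exists_eq_smul_of_dvd hdvd
      obtain ⟨hO, hfix⟩ := mem_stabPlus_conj hγ hγk (a⁻¹ * b)
      have hcong : (γ⁻¹ * (a⁻¹ * b).1 * γ) (Pi.single 1 1)
          = Pi.single 1 1 + (p : ℤ) • (γ⁻¹ * a.1 * γ)⁻¹ u := by
        rw [← map_smul, ← hu, map_sub, inv_apply_apply, add_sub_cancel, ← LinearEquiv.mul_apply]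
        congr 1
        simp only [Subgroup.coe_mul, Subgroup.coe_inv]
        group
      -- Equal invariants mean that a⁻¹b fixes f₁ modulo p, so it can be conjugated back to an
      -- element of `stabPlus h`, its preimage under ι.
      obtain ⟨g, hg⟩ := hpair.symm.exists_stabPlus_intertwined hq one_ne_zero hfk (a⁻¹ * b)
        fun y => by
          obtain ⟨z, hz⟩ := scale_conj_dvd_of_congr hpZ hO hfix ⟨_, hcong⟩ (α⁻¹ y)
          exact ⟨α z, by rw [hfx, hfx', ← map_smul, ← hz]; rfl⟩
      refine ⟨g, Subtype.ext (hpair.eq_of_intertwined hq.ne' fun x => ?_)⟩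
      rw [hι, hpair.symm.intertwined_symm hq.ne' hg])
  exact ⟨hfin, hle.trans (card_isotropicModP_le hp3)⟩

end KummerLattice

theorem mainTheorem2 (p : ℕ) (hp : p.Prime) (hp3 : 3 < p)
    (h k : KummerLattice.L)
    (h_split : KummerLattice.IsSplit h) (h_deg : KummerLattice.form h h = 2 * (p : ℤ) ^ 2)
    (k_split : KummerLattice.IsSplit k) (k_deg : KummerLattice.form k k = 2) :
    (∃ φ : KummerLattice.perp h →ₗ[ℤ] KummerLattice.perp k,
      KummerLattice.IsLatticeEmbedding φ) ∧
    ∀ φ : KummerLattice.perp h →ₗ[ℤ] KummerLattice.perp k,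
      KummerLattice.IsLatticeEmbedding φ →
      ∃ ι : KummerLattice.stabPlus h →* KummerLattice.stabPlus k,
        (∀ (g : KummerLattice.stabPlus h) (x : KummerLattice.perp h),
          KummerLattice.actPerp (ι g) (φ x) = φ (KummerLattice.actPerp g x)) ∧
        Function.Injective ι ∧
        ι.range.FiniteIndex ∧
        ι.range.index ≤ 16 * (p ^ 5 + p ^ 2) := by
  refine ⟨KummerLattice.exists_latticeEmbedding p hp.ne_zero h_split h_deg k_split k_deg,
    fun φ hφ => ?_⟩
  obtain ⟨ι, hι, hinj, hfin, hle⟩ :=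
    KummerLattice.exists_hom_range_index_le hp hp3 h_split h_deg k_split k_deg φ hφ
  exact ⟨ι, hι, hinj, hfin, by omega⟩
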